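/- Let $D$ be a Prüfer domain with quotient field $K$ (i.e. $D$ is an integral domain such that $D_P$ is a valuation domain for every $P\in\operatorname{Spec}(D)$), and let $\operatorname{Inv}(D)$ be the group of invertible fractional ideals of $D$ under multiplication, ordered by reverse containment. Let $X\subseteq\operatorname{Spec}(D)$ be a splitting set, i.e. a set closed under specialization (if $Q\in X$ and $Q\subseteq P\in\operatorname{Spec}(D)$ then $P\in X$) whose complement $\operatorname{Spec}(D)\setminus X$ is compact in the Zariski topology. Let $$\Omega(X):=\bigcap\{D_P : P\in\operatorname{Spec}(D)\setminus X\}\subseteq K$$ be the Nagata transform of $D$ with respect to $X$ (with $\Omega(X)=K$ if $X=\operatorname{Spec}(D)$), let $\operatorname{supp}(I):=\{P\in\operatorname{Spec}(D) : ID_P\neq D_P\}$ for a fractional ideal $I$, and let $$\operatorname{Inv}_X(D):=\{I\in\operatorname{Inv}(D) : \operatorname{supp}(I)\subseteq X\}.$$ Then $\operatorname{Inv}(D)$ is a lattice-ordered group, $\operatorname{Inv}_X(D)$ is a convex subgroup of $\operatorname{Inv}(D)$ (that is, $I<J<L$ with $I,L\in\operatorname{Inv}_X(D)$ implies $J\in\operatorname{Inv}_X(D)$),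 and there is a group isomorphism $$\operatorname{Inv}(D)/\operatorname{Inv}_X(D)\;\cong\;\operatorname{Inv}(\Omega(X)),$$ given by sending the class of $I$ to $I\,\Omega(X)$. If moreover $X\subseteq\operatorname{Max}(D)$, then $\operatorname{Inv}_X(D)$, with the induced order, is an archimedean lattice-ordered group: if $I,J\in\operatorname{Inv}_X(D)$ satisfy $J\subseteq I^n$ for all integers $n\geq 1$, then $D\subseteq I$. -/

import Mathlib

open scoped nonZeroDivisors

namespace PruferInv

section LGroups

variable (G : Type*) [CommGroup G] [PartialOrder G]

/-- A (commutative, multiplicatively written) `ℓ`-group: the order is translation invariant and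
any two elements have a supremum and an infimum. -/
structure IsLGroup : Prop where
  mul_le_mul : ∀ a b c : G, a ≤ b → c * a ≤ c * b
  exists_sup : ∀ a b : G, ∃ c, IsLUB {a, b} c
  exists_inf : ∀ a b : G, ∃ c, IsGLB {a, b} c

/-- An archimedean `ℓ`-group: if `a ^ n ≤ b` for all `n ≥ 1`, then `a ≤ 1`. -/
structure IsArchimedeanLGroup : Prop extends IsLGroup G where
  arch : ∀ a b : G, (∀ n : ℕ, 0 < n → a ^ n ≤ b) → a ≤ 1

variable {G}

/-- A subgroup is convex if `a < b < c` and `a, c ∈ H` imply `b ∈ H`. -/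
def IsConvexSubgroup (H : Subgroup G) : Prop :=
  ∀ a b c : G, a ∈ H → c ∈ H → a < b → b < c → b ∈ H

end LGroups

section Invertible

variable (R K : Type*) [CommRing R] [Field K] [Algebra R K]

/-- The group of invertible fractional ideals of `R`, as `R`-submodules of `K`
(here `K` is the quotient field of `R`). -/
def InvGroup : Type _ := (FractionalIdeal R⁰ K)ˣ

noncomputable instance : CommGroup (InvGroup R K) :=
  inferInstanceAs (CommGroup (FractionalIdeal R⁰ K)ˣ)

/-- The order on invertible ideals is the reverse containment. -/
instance : PartialOrder (InvGroup R K) :=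
  inferInstanceAs (PartialOrder ((FractionalIdeal R⁰ K)ˣ)ᵒᵈ)

variable {R K}

/-- The underlying fractional ideal of an invertible ideal. -/
def InvGroup.ideal (I : InvGroup R K) : FractionalIdeal R⁰ K := Units.val I

theorem InvGroup.le_iff (I J : InvGroup R K) : I ≤ J ↔ J.ideal ≤ I.ideal := Iff.rfl

theorem InvGroup.ideal_mul (I J : InvGroup R K) : (I * J).ideal = I.ideal * J.ideal := rfl

end Invertible

section Spectrum

variable {D : Type*} (K : Type*) [CommRing D] [IsDomain D] [Field K] [Algebra D K]
  [IsFractionRing D K]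

/-- The localization `D_P`, as a `D`-subalgebra of the quotient field `K`. -/
noncomputable def locAt (P : PrimeSpectrum D) : Subalgebra D K :=
  Localization.subalgebra.ofField K P.asIdeal.primeCompl
    P.asIdeal.primeCompl_le_nonZeroDivisors

theorem mem_locAt_iff (P : PrimeSpectrum D) (x : K) :
    x ∈ locAt K P ↔ ∃ a s : D, s ∉ P.asIdeal ∧ x = algebraMap D K a * (algebraMap D K s)⁻¹ := by
  constructor
  · rintro ⟨a, s, hs, h⟩
    exact ⟨a, s, hs, h⟩
  · rintro ⟨a, s, hs, h⟩
    exact ⟨a, s, hs, h⟩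

variable (D) in
/-- A Prüfer domain: `D_P` is a valuation domain for every prime ideal `P`. -/
def IsPrufer : Prop :=
  ∀ P : PrimeSpectrum D, ValuationRing (locAt K P)

/-- The Nagata transform `Ω(X) = ⋂ {D_P | P ∉ X^↑}`, where `X^↑` is the closure of `X` under
specialization (the intersection is taken inside `K`). -/
noncomputable def nagata (X : Set (PrimeSpectrum D)) : Subalgebra D K :=
  ⨅ P ∈ {P : PrimeSpectrum D | P ∉ upperClosure X}, locAt K P

/-- A splitting set: closed under specialization, and with complement compact in the
Zariski topology. -/
def IsSplittingSet (X : Set (PrimeSpectrum D)) : Prop :=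
  (upperClosure X : Set (PrimeSpectrum D)) = X ∧ IsCompact Xᶜ

variable {K}

/-- The support of a fractional ideal `I`: the primes `P` with `I D_P ≠ D_P`. -/
def supp (I : FractionalIdeal D⁰ K) : Set (PrimeSpectrum D) :=
  {P | Submodule.span (locAt K P) (I : Set K) ≠ 1}

variable (K)

/-- The set of `X`-invertible ideals of `D`. -/
def InvX (X : Set (PrimeSpectrum D)) : Set (InvGroup D K) :=
  {I | supp I.ideal ⊆ X}

end Spectrum

end PruferInv

open PruferInv

/-!
Over a Prüfer domain `D` every nonzero finitely generated fractional ideal `I` is invertible: at each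
prime `P` one of finitely many generators, say `x`, divides all the others in the valuation ring
`D_P`, and clearing denominators gives `s ∉ P` with `s x⁻¹ ∈ I⁻¹`, so that `s ∈ I I⁻¹`; hence
`I I⁻¹` lies in no maximal ideal (`isUnit_of_fg`). Everything else is built on this.

* Lattice structure: for invertible `I`, `J` the sum `I + J` is finitely generated, hence invertible,
  and it is the infimum of `I` and `J` for reverse containment. In an ordered abelian group, infima
  give suprema by inversion.
* The quotient: for an overring `S` of `D`, the map `I ↦ I S` is a homomorphism
  `Inv(D) → Inv(S)`. It is surjective because finitely many generators over `S` of an invertible ideal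
  generate over `D` an invertible ideal. Its kernel consists of the `I` with `I ⊆ S` and `I⁻¹ ⊆ S`
  (`mem_ker_extend_iff`). The same criterion, applied to `S = D_P`, describes the support, so for
  specialization-closed `X` the kernel for `S = Ω(X) = ⋂ D_P` is exactly `Inv_X(D)`. Convexity and
  closure under infima are then visible from the criterion.
* Archimedean property: let `J ⊆ I ^ n` for all `n ≥ 1` and suppose `D ⊄ I`. Then some `y ∈ I⁻¹` lies
  outside `V = D_P` for a maximal ideal `P`. The elements `x ∈ K` such that `y ^ n x ∈ V` for all
  `n ≥ 1` meet `D` in a prime `Q` strictly below `P`, so that `Q ∉ X` if `X` consists of maximal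
  ideals. The set of these elements contains `J` and is stable under addition and under
  multiplication by `D_Q`, hence by `J⁻¹`, as `Q` is not in the support of `J`. So it contains
  `1 ∈ J J⁻¹`, which says `y ∈ V`.
-/

namespace PruferInv

/-! ### Lattice-ordered groups from infima -/

section LGroups

variable {G : Type*} [CommGroup G] [PartialOrder G]

theorem IsLGroup.of_exists_inf (hmul : ∀ a b c : G, a ≤ b → c * a ≤ c * b)
    (hinf : ∀ a b : G, ∃ c, IsGLB {a, b} c) : IsLGroup G where
  mul_le_mul := hmul
  exists_inf := hinf
  exists_sup a b := by
    have hinv : ∀ x y : G, x ≤ y → y⁻¹ ≤ x⁻¹ := fun x y h => by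
      have := hmul x y (x⁻¹ * y⁻¹) h
      rwa [mul_right_comm, inv_mul_cancel, one_mul, mul_assoc, inv_mul_cancel, mul_one] at this
    obtain ⟨c, hc⟩ := hinf a⁻¹ b⁻¹
    refine ⟨c⁻¹, ?_, fun u hu => ?_⟩
    · rintro x (rfl | rfl)
      · simpa using hinv _ _ (hc.1 (Set.mem_insert _ _))
      · simpa using hinv _ _ (hc.1 (Set.mem_insert_of_mem _ rfl))
    · refine inv_inv u ▸ hinv _ _ (hc.2 ?_)
      rintro x (rfl | rfl)
      · exact hinv _ _ (hu (Set.mem_insert _ _))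
      · exact hinv _ _ (hu (Set.mem_insert_of_mem _ rfl))

end LGroups

/-! ### Ordered calculus of invertible ideals -/

section Invertible

variable {R K : Type*} [CommRing R] [Field K] [Algebra R K]

theorem InvGroup.ideal_ne_zero (I : InvGroup R K) : I.ideal ≠ 0 :=
  Units.ne_zero (M₀ := FractionalIdeal R⁰ K) I

theorem InvGroup.fg_ideal (I : InvGroup R K) : (I.ideal : Submodule R K).FG :=
  FractionalIdeal.fg_unit (S := R⁰) (P := K) I

theorem InvGroup.ideal_mul_ideal_inv (I : InvGroup R K) : I.ideal * (I⁻¹).ideal = 1 :=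
  Units.mul_inv (α := FractionalIdeal R⁰ K) I

/-- Since `1` is a finite sum of products from `I` and `I⁻¹`, it has every additive property shared by
those products. -/
theorem InvGroup.one_induction (I : InvGroup R K) {C : K → Prop}
    (hm : ∀ i ∈ I.ideal, ∀ j ∈ (I⁻¹).ideal, C (i * j)) (ha : ∀ x y, C x → C y → C (x + y)) :
    C 1 := by
  have h : (1 : K) ∈ I.ideal * (I⁻¹).ideal := by
    rw [I.ideal_mul_ideal_inv]
    exact FractionalIdeal.one_mem_one _
  exact FractionalIdeal.mul_induction_on h hm ha

theorem InvGroup.inv_le_inv {I J : InvGroup R K} (h : I ≤ J) : J⁻¹ ≤ I⁻¹ := by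
  have := mul_le_mul_right (show J.ideal ≤ I.ideal from h) ((I⁻¹).ideal * (J⁻¹).ideal)
  rw [mul_assoc, mul_comm _ J.ideal, J.ideal_mul_ideal_inv, mul_one, mul_right_comm,
    mul_comm _ I.ideal, I.ideal_mul_ideal_inv, one_mul] at this
  exact this

theorem InvGroup.isGLB_of_ideal_eq_add {I J L : InvGroup R K} (h : L.ideal = I.ideal + J.ideal) :
    IsGLB {I, J} L := by
  rw [← FractionalIdeal.sup_eq_add] at h
  refine ⟨?_, fun N hN => ?_⟩
  · rintro N (rfl | rfl)
    · exact le_sup_left.trans h.ge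
    · exact le_sup_right.trans h.ge
  · exact h.le.trans <| sup_le (hN (Set.mem_insert _ _)) (hN (Set.mem_insert_of_mem _ rfl))

theorem InvGroup.mul_le_mul (I J L : InvGroup R K) (h : I ≤ J) : L * I ≤ L * J := by
  rw [InvGroup.le_iff, InvGroup.ideal_mul, InvGroup.ideal_mul]
  exact mul_le_mul_right (show J.ideal ≤ I.ideal from h) _

theorem InvGroup.pow_mem_ideal_pow {I : InvGroup R K} {y : K} (hy : y ∈ I.ideal) (n : ℕ) :
    y ^ n ∈ (I ^ n).ideal := by
  induction n with
  | zero =>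
    rw [pow_zero, pow_zero]
    exact FractionalIdeal.one_mem_one _
  | succ n ih =>
    rw [pow_succ, pow_succ, InvGroup.ideal_mul]
    exact FractionalIdeal.mul_mem_mul ih hy

theorem InvGroup.pow_mul_mem_one {I J : InvGroup R K} {n : ℕ} (h : J.ideal ≤ (I ^ n).ideal) {y : K}
    (hy : y ∈ (I⁻¹).ideal) {x : K} (hx : x ∈ J.ideal) :
    y ^ n * x ∈ (1 : FractionalIdeal R⁰ K) := by
  have := FractionalIdeal.mul_mem_mul (h hx) (pow_mem_ideal_pow hy n)
  rwa [inv_pow, (I ^ n).ideal_mul_ideal_inv, mul_comm] at this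

/-- An invertible ideal generates the unit ideal of an overring `S` if and only if it and its inverse
are both contained in `S`. -/
theorem span_eq_one_iff (S : Subalgebra R K) (I : InvGroup R K) :
    Submodule.span S (I.ideal : Set K) = 1 ↔
      (∀ x ∈ I.ideal, x ∈ S) ∧ ∀ x ∈ (I⁻¹).ideal, x ∈ S := by
  have hone : ∀ x : K, x ∈ (1 : Submodule S K) ↔ x ∈ S := fun x => by
    rw [Submodule.mem_one]
    exact ⟨fun ⟨y, hy⟩ => hy ▸ y.2, fun h => ⟨⟨x, h⟩, rfl⟩⟩
  constructor
  · intro h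
    refine ⟨fun x hx => (hone x).1 (h ▸ Submodule.subset_span hx), fun x hx => ?_⟩
    have h1 : (1 : K) ∈ Submodule.span S (I.ideal : Set K) := by
      rw [h]
      exact (hone 1).2 (one_mem S)
    suffices ∀ y ∈ Submodule.span S (I.ideal : Set K), y * x ∈ S by simpa using this 1 h1
    intro y hy
    induction hy using Submodule.span_induction with
    | mem y hy =>
      have := FractionalIdeal.mul_mem_mul hy hx
      rw [I.ideal_mul_ideal_inv, FractionalIdeal.mem_one_iff] at this
      obtain ⟨d, hd⟩ := this
      exact hd ▸ S.algebraMap_mem d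
    | zero => simp
    | add y z _ _ hy hz => rw [add_mul]; exact add_mem hy hz
    | smul r y _ hy => rw [smul_mul_assoc]; exact mul_mem r.2 hy
  · rintro ⟨h, h'⟩
    refine le_antisymm (Submodule.span_le.2 fun x hx => (hone x).2 (h x hx)) ?_
    rw [Submodule.one_le]
    refine I.one_induction (fun i hi j hj => ?_) fun x y hx hy => add_mem hx hy
    rw [mul_comm]
    exact Submodule.smul_mem _ (⟨j, h' j hj⟩ : S) (Submodule.subset_span hi)

end Invertible

section Prufer

variable {D K : Type*} [CommRing D] [IsDomain D] [Field K] [Algebra D K] [IsFractionRing D K]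

/-! ### The valuation rings `D_P` inside the quotient field -/

theorem algebraMap_ne_zero_of_notMem {D K : Type*} [CommRing D] [Field K] [Algebra D K]
    [IsFractionRing D K] {P : PrimeSpectrum D} {s : D} (hs : s ∉ P.asIdeal) :
    algebraMap D K s ≠ 0 := by
  rw [Ne, FaithfulSMul.algebraMap_eq_zero_iff]
  rintro rfl
  exact hs (zero_mem _)

theorem algebraMap_inv_mem_locAt {P : PrimeSpectrum D} {s : D} (hs : s ∉ P.asIdeal) :
    (algebraMap D K s)⁻¹ ∈ locAt K P :=
  (mem_locAt_iff K P _).2 ⟨1, s, hs, by simp⟩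

theorem IsPrufer.mem_or_inv_mem (hD : IsPrufer D K) (P : PrimeSpectrum D) (x : K) :
    x ∈ locAt K P ∨ x⁻¹ ∈ locAt K P := by
  have := hD P
  have : IsFractionRing (locAt K P) K :=
    inferInstanceAs (IsFractionRing (Localization.subalgebra.ofField K P.asIdeal.primeCompl
      P.asIdeal.primeCompl_le_nonZeroDivisors) K)
  rcases ValuationRing.isInteger_or_isInteger (locAt K P) x with ⟨a, ha⟩ | ⟨a, ha⟩
  · exact Or.inl (ha ▸ a.2)
  · exact Or.inr (ha ▸ a.2)

/-- Elements outside the valuation ring `D_P` are the inverses of its nonzero nonunits, so they are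
closed under multiplication. -/
theorem IsPrufer.mul_notMem (hD : IsPrufer D K) {P : PrimeSpectrum D} {x y : K}
    (hx : x ∉ locAt K P) (hy : y ∉ locAt K P) : x * y ∉ locAt K P := by
  intro h
  have hy' := (hD.mem_or_inv_mem P y).resolve_left hy
  have hy0 : y ≠ 0 := by rintro rfl; exact hy (zero_mem _)
  exact hx (by simpa [hy0] using mul_mem h hy')

/-- One of finitely many elements of `K` divides all of them in the valuation ring `D_P`. -/
theorem IsPrufer.exists_local_generator (hD : IsPrufer D K) (P : PrimeSpectrum D) {t : Finset K}
    (ht : t.Nonempty) : ∃ x ∈ t, ∀ y ∈ t, ∃ v ∈ locAt K P, y = v * x := by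
  induction ht using Finset.Nonempty.cons_induction with
  | singleton a => exact ⟨a, by simp, fun y hy => ⟨1, one_mem _, by simp_all⟩⟩
  | cons a s has hs ih =>
    obtain ⟨x, hxs, hx⟩ := ih
    have key : (∃ v ∈ locAt K P, a = v * x) ∨ ∃ v ∈ locAt K P, x = v * a := by
      rcases eq_or_ne x 0 with rfl | hx0
      · exact Or.inr ⟨0, zero_mem _, by simp⟩
      rcases eq_or_ne a 0 with rfl | ha0
      · exact Or.inl ⟨0, zero_mem _, by simp⟩
      rcases hD.mem_or_inv_mem P (a * x⁻¹) with h | h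
      · exact Or.inl ⟨_, h, by field_simp⟩
      · exact Or.inr ⟨_, h, by field_simp⟩
    rcases key with ha | ⟨w, hw, hxw⟩
    · refine ⟨x, by simp [hxs], fun y hy => ?_⟩
      rcases Finset.mem_cons.1 hy with rfl | hy
      exacts [ha, hx y hy]
    · refine ⟨a, by simp, fun y hy => ?_⟩
      rcases Finset.mem_cons.1 hy with rfl | hy
      · exact ⟨1, one_mem _, by simp⟩
      · obtain ⟨v, hv, rfl⟩ := hx y hy
        exact ⟨v * w, mul_mem hv hw, by rw [mul_assoc, ← hxw]⟩

theorem exists_common_denominator (P : PrimeSpectrum D) (t : Finset K) (f : K → K)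
    (ht : ∀ y ∈ t, f y ∈ locAt K P) :
    ∃ s : D, s ∉ P.asIdeal ∧ ∀ y ∈ t, ∃ d : D, algebraMap D K d = algebraMap D K s * f y := by
  classical
  induction t using Finset.induction_on with
  | empty => exact ⟨1, (Ideal.ne_top_iff_one _).1 P.isPrime.ne_top, by simp⟩
  | insert a t _ ih =>
    obtain ⟨s, hs, hst⟩ := ih fun y hy => ht y (Finset.mem_insert_of_mem hy)
    obtain ⟨b, r, hr, hbr⟩ := (mem_locAt_iff K P _).1 (ht a (Finset.mem_insert_self _ _))
    have hr0 : algebraMap D K r ≠ 0 := algebraMap_ne_zero_of_notMem hr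
    refine ⟨s * r, fun h => (P.isPrime.mem_or_mem h).elim hs hr, fun y hy => ?_⟩
    rcases Finset.mem_insert.1 hy with rfl | hy
    · exact ⟨s * b, by rw [hbr, map_mul, map_mul]; field_simp⟩
    · obtain ⟨d, hd⟩ := hst y hy
      exact ⟨r * d, by rw [map_mul, hd, map_mul]; ring⟩

/-! ### Finitely generated ideals are invertible -/

theorem IsPrufer.isUnit_of_fg (hD : IsPrufer D K) {I : FractionalIdeal D⁰ K} (hI : I ≠ 0)
    (hfg : (I : Submodule D K).FG) : IsUnit I := by
  obtain ⟨t, ht⟩ := hfg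
  have htI : ∀ y ∈ t, y ∈ I := fun y hy => by
    rw [← FractionalIdeal.mem_coe, ← ht]
    exact Submodule.subset_span hy
  have htne : t.Nonempty := by
    rw [Finset.nonempty_iff_ne_empty]
    rintro rfl
    exact hI (FractionalIdeal.coeToSubmodule_eq_bot.1 (by simpa using ht.symm))
  rw [← FractionalIdeal.mul_inv_cancel_iff_isUnit]
  refine le_antisymm FractionalIdeal.mul_one_div_le_one ?_
  rw [FractionalIdeal.one_le]
  -- the ideal `I * I⁻¹` of `D`
  let A : Ideal D :=
    ((I * I⁻¹ : FractionalIdeal D⁰ K) : Submodule D K).comap (Algebra.linearMap D K)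
  by_contra h1
  have hA : A ≠ ⊤ := fun h => h1 <| by
    have : (1 : D) ∈ A := h ▸ Submodule.mem_top
    simpa only [A, Submodule.mem_comap, Algebra.linearMap_apply, map_one,
      FractionalIdeal.mem_coe] using this
  obtain ⟨M, hM, hAM⟩ := Ideal.exists_le_maximal A hA
  let P : PrimeSpectrum D := ⟨M, hM.isPrime⟩
  obtain ⟨x, hxt, hx⟩ := hD.exists_local_generator P htne
  have hx0 : x ≠ 0 := by
    rintro rfl
    refine hI (FractionalIdeal.coeToSubmodule_eq_bot.1 ?_)
    rw [← ht, Submodule.span_eq_bot]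
    intro y hy
    obtain ⟨v, -, rfl⟩ := hx y hy
    simp
  obtain ⟨s, hs, hst⟩ := exists_common_denominator P t (fun y => y * x⁻¹) fun y hy => by
    obtain ⟨v, hv, rfl⟩ := hx y hy
    simpa [hx0] using hv
  have hsI : algebraMap D K s * x⁻¹ ∈ I⁻¹ := by
    rw [FractionalIdeal.mem_inv_iff hI]
    intro y hy
    rw [← FractionalIdeal.mem_coe, ← ht] at hy
    induction hy using Submodule.span_induction with
    | mem y hy =>
      obtain ⟨d, hd⟩ := hst y hy
      exact (FractionalIdeal.mem_one_iff _).2 ⟨d, by rw [hd]; ring⟩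
    | zero => simp
    | add y z _ _ hy hz =>
      rw [mul_add]
      exact Submodule.add_mem ((1 : FractionalIdeal D⁰ K) : Submodule D K) hy hz
    | smul r y _ hy => rw [mul_smul_comm]; exact Submodule.smul_mem _ r hy
  refine hs (hAM ?_)
  have := FractionalIdeal.mul_mem_mul (htI x hxt) hsI
  rwa [mul_left_comm, mul_inv_cancel₀ hx0, mul_one] at this

/-! ### The lattice order on the group of invertible ideals -/

theorem IsPrufer.exists_ideal_eq (hD : IsPrufer D K) {I : FractionalIdeal D⁰ K} (hI : I ≠ 0)
    (hfg : (I : Submodule D K).FG) : ∃ L : InvGroup D K, L.ideal = I :=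
  hD.isUnit_of_fg hI hfg

theorem IsPrufer.exists_ideal_eq_add (hD : IsPrufer D K) (I J : InvGroup D K) :
    ∃ L : InvGroup D K, L.ideal = I.ideal + J.ideal := by
  refine hD.exists_ideal_eq (fun h => I.ideal_ne_zero ?_) ?_
  · rw [← FractionalIdeal.sup_eq_add] at h
    exact FractionalIdeal.le_zero_iff.1 (h ▸ le_sup_left)
  · rw [FractionalIdeal.coe_add]
    exact I.fg_ideal.sup J.fg_ideal

theorem IsPrufer.isLGroup (hD : IsPrufer D K) : IsLGroup (InvGroup D K) :=
  .of_exists_inf InvGroup.mul_le_mul fun I J =>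
    (hD.exists_ideal_eq_add I J).imp fun _ h => InvGroup.isGLB_of_ideal_eq_add h

/-! ### Extension of invertible ideals to an overring -/

instance isFractionRing_subalgebra (S : Subalgebra D K) : IsFractionRing S K :=
  IsFractionRing.of_field S K fun z => by
    obtain ⟨a, b, -, rfl⟩ := IsFractionRing.div_surjective D z
    exact ⟨algebraMap D S a, algebraMap D S b, rfl⟩

/-- The homomorphism `I ↦ I S` from the invertible ideals of `D` to those of an overring `S` of `D`
inside the quotient field. -/
noncomputable def extend (S : Subalgebra D K) : InvGroup D K →* InvGroup S K :=
  Units.map (FractionalIdeal.extendedHom (A := D) (K := K) K S).toMonoidHom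

theorem coe_extend (S : Subalgebra D K) (I : InvGroup D K) :
    ((extend S I).ideal : Submodule S K) = Submodule.span S (I.ideal : Set K) := by
  have hmap : IsLocalization.map K (algebraMap D S)
      (nonZeroDivisors_le_comap_nonZeroDivisors_of_injective _
        (FaithfulSMul.algebraMap_injective D S)) = RingHom.id K :=
    IsLocalization.map_unique _ _ fun _ => rfl
  change ((FractionalIdeal.extendedHom K S I.ideal : FractionalIdeal S⁰ K) : Submodule S K) = _
  rw [FractionalIdeal.extendedHom'_apply, FractionalIdeal.coe_extended_eq_span, hmap]
  simp

theorem mem_ker_extend_iff (S : Subalgebra D K) (I : InvGroup D K) :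
    I ∈ (extend S).ker ↔ (∀ x ∈ I.ideal, x ∈ S) ∧ ∀ x ∈ (I⁻¹).ideal, x ∈ S := by
  rw [← span_eq_one_iff, ← coe_extend, MonoidHom.mem_ker]
  refine ⟨fun h => h ▸ FractionalIdeal.coe_one (S := S⁰) (P := K), fun h => Units.ext ?_⟩
  exact FractionalIdeal.coeToSubmodule_injective
    (h.trans (FractionalIdeal.coe_one (S := S⁰) (P := K)).symm)

theorem mem_ker_extend_of_le_of_le {S : Subalgebra D K} {I J L : InvGroup D K}
    (hI : I ∈ (extend S).ker) (hL : L ∈ (extend S).ker) (hIJ : I ≤ J) (hJL : J ≤ L) :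
    J ∈ (extend S).ker := by
  rw [mem_ker_extend_iff] at *
  exact ⟨fun x hx => hI.1 x (hIJ hx), fun x hx => hL.2 x (InvGroup.inv_le_inv hJL hx)⟩

/-- Generators over `S` of an invertible ideal generate over `D` an ideal that is invertible as `D` is
Prüfer. -/
theorem IsPrufer.extend_surjective (hD : IsPrufer D K) (S : Subalgebra D K) :
    Function.Surjective (extend S) := by
  intro J
  obtain ⟨t, ht⟩ := J.fg_ideal
  have hfg : (Submodule.span D (t : Set K)).FG := ⟨t, rfl⟩
  let I : FractionalIdeal D⁰ K := ⟨_, FractionalIdeal.isFractional_of_fg hfg⟩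
  have hI : I ≠ 0 := fun h => J.ideal_ne_zero <| by
    have h0 : Submodule.span D (t : Set K) = ⊥ := FractionalIdeal.coeToSubmodule_eq_bot.2 h
    rw [Submodule.span_eq_bot] at h0
    exact FractionalIdeal.coeToSubmodule_eq_bot.1 (ht.symm.trans (Submodule.span_eq_bot.2 h0))
  obtain ⟨L, hL⟩ := hD.exists_ideal_eq hI hfg
  refine ⟨L, Units.ext (FractionalIdeal.coeToSubmodule_injective ?_)⟩
  refine (coe_extend S L).trans (Eq.trans ?_ ht)
  rw [hL]
  exact Submodule.span_span_of_tower D S (t : Set K)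

theorem IsPrufer.isLGroup_ker_extend (hD : IsPrufer D K) (S : Subalgebra D K) :
    IsLGroup (extend S).ker := by
  refine .of_exists_inf (fun I J L h => InvGroup.mul_le_mul _ _ _ h) fun I J => ?_
  obtain ⟨L, hL⟩ := hD.exists_ideal_eq_add I.1 J.1
  have hglb := InvGroup.isGLB_of_ideal_eq_add hL
  have hLI : L ≤ I.1 := hglb.1 (Set.mem_insert _ _)
  have hLJ : L ≤ J.1 := hglb.1 (Set.mem_insert_of_mem _ rfl)
  have hmem : L ∈ (extend S).ker := by
    rw [mem_ker_extend_iff]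
    refine ⟨fun x hx => ?_, fun x hx =>
      ((mem_ker_extend_iff S _).1 I.2).2 x (InvGroup.inv_le_inv hLI hx)⟩
    rw [hL, FractionalIdeal.mem_add] at hx
    obtain ⟨i, hi, j, hj, rfl⟩ := hx
    exact add_mem (((mem_ker_extend_iff S _).1 I.2).1 i hi)
      (((mem_ker_extend_iff S _).1 J.2).1 j hj)
  refine ⟨⟨L, hmem⟩, ?_, fun N hN => hglb.2 ?_⟩
  · rintro N (rfl | rfl)
    exacts [hLI, hLJ]
  · rintro _ (rfl | rfl)
    · exact hN (Set.mem_insert _ _)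
    · exact hN (Set.mem_insert_of_mem _ rfl)

/-! ### Support and the Nagata transform -/

theorem notMem_supp_iff (P : PrimeSpectrum D) (I : InvGroup D K) :
    P ∉ supp I.ideal ↔
      (∀ x ∈ I.ideal, x ∈ locAt K P) ∧ ∀ x ∈ (I⁻¹).ideal, x ∈ locAt K P := by
  rw [← span_eq_one_iff]
  exact not_not

theorem mem_nagata_iff {X : Set (PrimeSpectrum D)}
    (hX : (upperClosure X : Set (PrimeSpectrum D)) = X) (x : K) :
    x ∈ nagata K X ↔ ∀ P ∉ X, x ∈ locAt K P := by
  have h : ∀ P : PrimeSpectrum D, P ∈ upperClosure X ↔ P ∈ X := fun P => by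
    rw [← SetLike.mem_coe, hX]
  simp only [nagata, Algebra.mem_iInf, Set.mem_ofPred_eq, h]

theorem coe_ker_extend_nagata {X : Set (PrimeSpectrum D)}
    (hX : (upperClosure X : Set (PrimeSpectrum D)) = X) :
    ((extend (nagata K X)).ker : Set (InvGroup D K)) = InvX K X := by
  ext I
  have : I ∈ InvX K X ↔ ∀ P ∉ X, P ∉ supp I.ideal :=
    ⟨fun h P hP hs => hP (h hs), fun h P hs => by_contra fun hP => h P hP hs⟩
  rw [this, SetLike.mem_coe, mem_ker_extend_iff]
  simp only [notMem_supp_iff, mem_nagata_iff hX]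
  grind

/-! ### The archimedean property -/

/-- If no power `y ^ n`, `n ≥ 1`, multiplies `J` out of `D_P`, where `y` lies outside `D_P`, then
the support of `J` contains a prime strictly below `P`: the prime of the elements of `D` divisible in
`D_P` by all powers of the nonunit `y⁻¹`. -/
theorem IsPrufer.exists_lt_mem_supp (hD : IsPrufer D K) {P : PrimeSpectrum D} {y : K}
    (hy : y ∉ locAt K P) {J : InvGroup D K}
    (hJ : ∀ n : ℕ, ∀ x ∈ J.ideal, y ^ (n + 1) * x ∈ locAt K P) :
    ∃ Q : PrimeSpectrum D, Q < P ∧ Q ∈ supp J.ideal := by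
  have hy0 : y ≠ 0 := by rintro rfl; exact hy (zero_mem _)
  let Q₀ : Ideal D :=
    { carrier := {d | ∀ n : ℕ, y ^ (n + 1) * algebraMap D K d ∈ locAt K P}
      zero_mem' := fun n => by simp
      add_mem' := fun ha hb n => by rw [map_add, mul_add]; exact add_mem (ha n) (hb n)
      smul_mem' := fun c d hd n => by
        rw [smul_eq_mul, map_mul, mul_left_comm]
        exact mul_mem (algebraMap_mem _ c) (hd n) }
  have hQ : ∀ d, d ∈ Q₀ ↔ ∀ n : ℕ, y ^ (n + 1) * algebraMap D K d ∈ locAt K P :=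
    fun d => Iff.rfl
  have hprime : Q₀.IsPrime := by
    refine ⟨fun h => hy ?_, fun {a b} hab => ?_⟩
    · have := (hQ 1).1 ((Ideal.eq_top_iff_one _).1 h) 0
      simpa using this
    · by_contra! hcon
      simp only [hQ, not_forall] at hcon
      obtain ⟨⟨n, hn⟩, m, hm⟩ := hcon
      refine hD.mul_notMem hn hm ?_
      have := (hQ _).1 hab (n + m + 1)
      rw [map_mul] at this
      convert this using 1
      ring
  let Q : PrimeSpectrum D := ⟨Q₀, hprime⟩
  refine ⟨Q, lt_of_le_not_ge (fun d hd => ?_) fun hPQ => ?_, ?_⟩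
  · by_contra hdP
    have hd0 : algebraMap D K d ≠ 0 := algebraMap_ne_zero_of_notMem hdP
    have := mul_mem ((hQ d).1 hd 0) (algebraMap_inv_mem_locAt (K := K) hdP)
    exact hy (by simpa [hd0] using this)
  · -- the numerator of the nonunit `y⁻¹` lies in `P`, but it is not divisible by `y⁻¹ ^ 2`
    obtain ⟨a, s, hs, has⟩ := (mem_locAt_iff K P _).1 ((hD.mem_or_inv_mem P y).resolve_left hy)
    have hs0 : algebraMap D K s ≠ 0 := algebraMap_ne_zero_of_notMem hs
    have ha : algebraMap D K a = y⁻¹ * algebraMap D K s := by rw [has]; field_simp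
    have haP : a ∈ P.asIdeal := by
      by_contra haP
      refine hy ((mem_locAt_iff K P _).2 ⟨s, a, haP, ?_⟩)
      rw [ha, mul_inv, inv_inv, mul_left_comm, mul_inv_cancel₀ hs0, mul_one]
    have := mul_mem ((hQ a).1 (hPQ haP) 1) (algebraMap_inv_mem_locAt (K := K) hs)
    rw [ha] at this
    refine hy ?_
    convert this using 1
    field_simp
  · by_contra hsupp
    have hinv := ((notMem_supp_iff Q J).1 hsupp).2
    have h1 : ∀ n : ℕ, y ^ (n + 1) * (1 : K) ∈ locAt K P := by
      refine J.one_induction (C := fun x => ∀ n : ℕ, y ^ (n + 1) * x ∈ locAt K P)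
        (fun i hi j hj n => ?_) fun u v hu hv n => by rw [mul_add]; exact add_mem (hu n) (hv n)
      obtain ⟨d, s, hs, rfl⟩ := (mem_locAt_iff K Q _).1 (hinv j hj)
      -- as `s ∉ Q`, some `y ^ (m + 1) * s` lies outside the valuation ring `D_P`, so its inverse lies
      -- in `D_P`: a further factor `y ^ (m + 1)` absorbs the denominator `s`
      obtain ⟨m, hm⟩ := not_forall.1 (fun h => hs ((hQ s).2 h))
      have hm' := (hD.mem_or_inv_mem P _).resolve_left hm
      have := mul_mem (mul_mem (hJ (n + m + 1) i hi) (algebraMap_mem (locAt K P) d)) hm'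
      convert this using 1
      rw [mul_inv]
      field_simp
      ring
    exact hy (by simpa using h1 0)

theorem exists_notMem_locAt_of_notMem_one {y : K} (hy : y ∉ (1 : FractionalIdeal D⁰ K)) :
    ∃ P : PrimeSpectrum D, y ∉ locAt K P := by
  -- the ideal of denominators of `y`
  let A : Ideal D := ((1 : Submodule D K).comap (LinearMap.toSpanSingleton D K y))
  have hmem : ∀ d, d ∈ A ↔ ∃ c, algebraMap D K c = algebraMap D K d * y := fun d => by
    simp [A, Submodule.mem_one, Algebra.smul_def]
  have hA : A ≠ ⊤ := fun h => hy <| by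
    obtain ⟨c, hc⟩ := (hmem 1).1 (h ▸ Submodule.mem_top)
    exact (FractionalIdeal.mem_one_iff _).2 ⟨c, by simpa using hc⟩
  obtain ⟨M, hM, hAM⟩ := Ideal.exists_le_maximal A hA
  refine ⟨⟨M, hM.isPrime⟩, fun h => ?_⟩
  obtain ⟨a, s, hs, rfl⟩ := (mem_locAt_iff K _ _).1 h
  have hs0 : algebraMap D K s ≠ 0 := algebraMap_ne_zero_of_notMem hs
  exact hs (hAM ((hmem s).2 ⟨a, by field_simp⟩))

theorem IsPrufer.le_one_of_pow_le (hD : IsPrufer D K) {X : Set (PrimeSpectrum D)}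
    (hX : ∀ P ∈ X, P.asIdeal.IsMaximal) {I J : InvGroup D K} (hJ : J ∈ InvX K X)
    (h : ∀ n : ℕ, 0 < n → I ^ n ≤ J) : I ≤ 1 := by
  suffices hinv : (I⁻¹).ideal ≤ 1 by
    have := InvGroup.inv_le_inv (show (1 : InvGroup D K) ≤ I⁻¹ from hinv)
    simpa using this
  intro y hy
  by_contra hy1
  obtain ⟨P, hP⟩ := exists_notMem_locAt_of_notMem_one hy1
  obtain ⟨Q, hQP, hQ⟩ := hD.exists_lt_mem_supp hP (J := J) fun n x hx => by
    obtain ⟨d, hd⟩ := (FractionalIdeal.mem_one_iff _).1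
      (InvGroup.pow_mul_mem_one (h (n + 1) n.succ_pos) hy hx)
    exact hd ▸ algebraMap_mem _ d
  exact hQP.ne (PrimeSpectrum.ext ((hX Q (hJ hQ)).eq_of_le P.isPrime.ne_top hQP.le))

end Prufer

end PruferInv

theorem mainTheorem10 (D K : Type*) [CommRing D] [IsDomain D] [Field K] [Algebra D K]
    [IsFractionRing D K] (hD : IsPrufer D K)
    (X : Set (PrimeSpectrum D)) (hX : IsSplittingSet X) :
    IsLGroup (InvGroup D K) ∧
    ∃ H : Subgroup (InvGroup D K),
      (H : Set (InvGroup D K)) = InvX K X ∧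
      IsConvexSubgroup H ∧
      (∃ e : InvGroup D K ⧸ H ≃* InvGroup (nagata K X) K,
        ∀ I : InvGroup D K,
          ((e (QuotientGroup.mk I)).ideal : Submodule (nagata K X) K) =
            Submodule.span (nagata K X) (I.ideal : Set K)) ∧
      ((∀ P ∈ X, P.asIdeal.IsMaximal) → IsArchimedeanLGroup H) := by
  have hker := coe_ker_extend_nagata (K := K) hX.1
  refine ⟨hD.isLGroup, (extend (nagata K X)).ker, hker, ?_, ?_, fun hmax => ?_⟩
  · exact fun I J L hI hL hIJ hJL => mem_ker_extend_of_le_of_le hI hL hIJ.le hJL.le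
  · exact ⟨QuotientGroup.quotientKerEquivOfSurjective _ (hD.extend_surjective _),
      fun I => coe_extend _ I⟩
  · exact
      { hD.isLGroup_ker_extend (nagata K X) with
        arch := fun I J h => hD.le_one_of_pow_le hmax (hker.subset J.2) h }
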